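/- **Theorem 1.6.** Let $P$ be an interval order, that is, a partially ordered set isomorphic to a set of nonempty intervals (order-convex subsets) of some chain $C$, where $I<J$ means that $x<y$ for all $x\in I$, $y\in J$. Then $P$ is better-quasi-ordered (bqo) if and only if $P$ is well-quasi-ordered (wqo). Here $P$ is *wqo* if it is well-founded and has no infinite antichain, equivalently, if for every sequence $(x_n)_{n\in\mathbb N}$ in $P$ there are $m<n$ with $x_m\le x_n$. Finite subsets of $\mathbb N$ are identified with strictly increasing finite sequences. A *barrier* is an infinite set $B$ of finite subsets of $\mathbb N$ that is an antichain for inclusion and such that every infinite $X\subseteq\bigcup B$ has a nonempty initial segment belonging to $B$. For finite $s,t\subseteq\mathbb N$ write $s\triangleleft t$ if there is a finite $r\subseteq\mathbb N$ such that $s$ is a proper initial segment of $r$ and $t$ is obtained from $r$ by deleting its least element. The order type of a barrier is taken with respect to the lexicographic order, which well-orders it. For a countable ordinal $\alpha$, $P$ is *$\alpha$-bqo* if for every barrier $B$ of order type at most $\alpha$ and every map $f:B\to P$ there are $s,t\in B$ with $s\triangleleft t$ and $f(s)\le f(t)$. $P$ is *bqo* if it is $\alpha$-bqo for every countable ordinal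 $\alpha$. -/

import Mathlib

universe u v

namespace Bqo

/-! ### Finite sets of natural numbers, seen as strictly increasing sequences -/

/-- `s ≤_in X`: the finite set `s`, listed increasingly, is an initial segment of the set `X`. -/
def IsInit (s : Finset ℕ) (X : Set ℕ) : Prop :=
  (s : Set ℕ) ⊆ X ∧ ∀ x ∈ X, ∀ y ∈ s, x ≤ y → x ∈ s

/-- The sequence `s` without its first (least) element; the empty sequence stays empty. -/
def tail (s : Finset ℕ) : Finset ℕ :=
  s.filter fun x => ∃ y ∈ s, y < x

/-- `s ◁ t`: there is a finite `r` of which `s` is a proper initial segment and such that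
`t` is `r` without its first element. -/
def Tri (s t : Finset ℕ) : Prop :=
  ∃ r : Finset ℕ, IsInit s r ∧ s ≠ r ∧ t = tail r

/-- The strict lexicographic order on finite sets of natural numbers, each listed increasingly. -/
def LexLT (s t : Finset ℕ) : Prop :=
  List.Lex (· < ·) (s.sort (· ≤ ·)) (t.sort (· ≤ ·))

/-! ### Barriers and better-quasi-orders -/

/-- The union `⋃ B` of a set `B` of finite sets of natural numbers. -/
def base (B : Set (Finset ℕ)) : Set ℕ := {n | ∃ s ∈ B, n ∈ s}

/-- A block: an infinite set of finite sets of natural numbers such that every infinite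
`X ⊆ ⋃ B` has a nonempty initial segment in `B`. -/
def IsBlock (B : Set (Finset ℕ)) : Prop :=
  B.Infinite ∧ ∀ X : Set ℕ, X.Infinite → X ⊆ base B → ∃ s ∈ B, s ≠ ∅ ∧ IsInit s X

/-- A barrier: a block that is an antichain for inclusion. -/
def IsBarrier (B : Set (Finset ℕ)) : Prop :=
  IsBlock B ∧ IsAntichain (· ⊆ ·) B

/-- `B` is well ordered by the lexicographic order, with order type at most `α`. -/
def LexTypeLE (B : Set (Finset ℕ)) (α : Ordinal.{0}) : Prop :=
  ∃ _ : IsWellOrder B (fun s t => LexLT s t), Ordinal.type (fun s t : B => LexLT s t) ≤ α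

/-- A map from `B` into `P` is good if `f s ≤ f t` for some `s ◁ t` in `B`. -/
def IsGood {P : Type*} [LE P] {B : Set (Finset ℕ)} (f : B → P) : Prop :=
  ∃ s t : B, Tri s t ∧ f s ≤ f t

/-- `P` is `α`-better-quasi-ordered: every map into `P` from a barrier of order type at most `α`
is good. -/
def IsAlphaBqo (α : Ordinal.{0}) (P : Type*) [LE P] : Prop :=
  ∀ B : Set (Finset ℕ), IsBarrier B → LexTypeLE B α → ∀ f : B → P, IsGood f

/-- `P` is better-quasi-ordered: it is `α`-better-quasi-ordered for every countable ordinal `α`. -/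
def IsBqo (P : Type*) [LE P] : Prop :=
  ∀ α : Ordinal.{0}, α.card ≤ Cardinal.aleph0 → IsAlphaBqo α P

/-! ### Interval orders -/

/-- The nonempty intervals (order-convex subsets) of a chain `C`. -/
def Intervals (C : Type*) [LinearOrder C] : Type _ :=
  {I : Set C // I.Nonempty ∧ I.OrdConnected}

/-- Intervals are ordered by `I < J` iff every element of `I` is less than every element of `J`. -/
instance (C : Type*) [LinearOrder C] : PartialOrder (Intervals C) where
  le I J := I = J ∨ ∀ x ∈ I.1, ∀ y ∈ J.1, x < y
  lt I J := ∀ x ∈ I.1, ∀ y ∈ J.1, x < y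
  le_refl I := Or.inl rfl
  le_trans I J K := by
    rintro (rfl | h) (rfl | h')
    · exact Or.inl rfl
    · exact Or.inr h'
    · exact Or.inr h
    · obtain ⟨j, hj⟩ := J.2.1
      exact Or.inr fun x hx z hz => (h x hx j hj).trans (h' j hj z hz)
  lt_iff_le_not_ge I J := by
    obtain ⟨i, hi⟩ := I.2.1
    obtain ⟨j, hj⟩ := J.2.1
    constructor
    · intro h
      refine ⟨Or.inr h, ?_⟩
      rintro (rfl | h')
      · exact lt_irrefl _ (h i hi i hi)
      · exact lt_asymm (h i hi j hj) (h' j hj i hi)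
    · rintro ⟨rfl | h, h'⟩
      · exact absurd (Or.inl rfl) h'
      · exact h
  le_antisymm I J := by
    rintro (rfl | h) (h' | h')
    · rfl
    · rfl
    · exact h'.symm
    · obtain ⟨i, hi⟩ := I.2.1
      obtain ⟨j, hj⟩ := J.2.1
      exact absurd (h' j hj i hi) (lt_asymm (h i hi j hj))

/-- `P` is an interval order: it is isomorphic, as a poset, to a set of nonempty intervals of some
chain. -/
def IsIntervalOrder (P : Type u) [PartialOrder P] : Prop :=
  ∃ (C : Type v) (_ : LinearOrder C) (S : Set (Intervals C)), Nonempty (P ≃o S)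

end Bqo

/-!
Call a property of infinite sequences almost sure, for an ultrafilter `U` on their terms, if it
holds for all branches of some tree in which every node has `U`-almost all of its children. A
locally constant property is decided: it or its negation is almost sure. Consequently, when `β` is
well-founded, a locally constant `β`-valued `G` almost surely satisfies `¬ G x.tail < G x`:
otherwise the iterated tails of some sequence would give an infinite descent.

Let `F` be a locally constant map from sequences to a well-quasi-order `P` without `2 + 2`; we show
that almost surely `F x ≤ F x.tail`. Every `x` has a first prefix that settles the value of `F`. A
prefix `s` that does not settle it has a limit ideal, the set of all `y` almost surely below
`F (s ++ₛ z)`; it contains `F (s ++ₛ z)` for almost all `z` and has no maximal element, so that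
`2 + 2`-freeness makes any two of these ideals comparable. Almost surely, then, passing from `x` to
`x.tail` neither shortens the settling prefix nor shrinks the limit ideal of the prefix just before
settling. Hence `F x` belongs to the limit ideal at a prefix `s` of `x.tail` which does not yet
settle `F`, while the prefix of `x` of length `s.length + 1` already settles the value `F x`.

A map `f` from a barrier `B` gives such an `F`, namely `f s` at any increasing sequence `x` with
prefix `s ∈ B`, and `s ◁ t` for the prefixes `s` of `x` and `t` of `x.tail`. Conversely,
well-quasi-ordering is the case of the barrier of singletons.
-/

namespace Bqo

open Stream' Filter

section Stream

variable {A β : Type*}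

theorem take_eq_take_iff {x z : Stream' A} {n : ℕ} :
    z.take n = x.take n ↔ ∀ i < n, z.get i = x.get i := by
  simp [List.ext_getElem_iff]

theorem take_take_append (x z : Stream' A) {m n : ℕ} (h : m ≤ n) :
    (x.take n ++ₛ z).take m = x.take m := by
  rw [take_append_of_le_length m _ _ (by rwa [length_take]), take_take, min_eq_right h]

theorem exists_get_eq_take (p : List A → A) : ∃ x : Stream' A, ∀ n, x.get n = p (x.take n) := by
  let pre : ℕ → List A := Nat.rec [] fun _ s => s ++ [p s]
  let x : Stream' A := fun n => p (pre n)
  have take_x (n : ℕ) : x.take n = pre n := by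
    induction n with
    | zero => rfl
    | succ n ih => rw [take_succ', ih]; rfl
  exact ⟨x, fun n => by rw [take_x]; rfl⟩

variable [TopologicalSpace A]

/-- The product topology on infinite sequences. With `A` discrete, a function on `Stream' A` is
locally constant iff each of its values is determined by a finite prefix of the argument. -/
instance : TopologicalSpace (Stream' A) := Pi.topologicalSpace

theorem continuous_streamTail : Continuous (Stream'.tail : Stream' A → Stream' A) :=
  continuous_pi fun i => continuous_apply (i + 1)

theorem continuous_cons (a : A) : Continuous fun x : Stream' A => a :: x :=
  continuous_pi fun
    | 0 => continuous_const
    | i + 1 => continuous_apply i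

theorem continuous_append : ∀ s : List A, Continuous fun x : Stream' A => s ++ₛ x
  | [] => continuous_id
  | List.cons a s => (continuous_cons a).comp (continuous_append s)

theorem isLocallyConstant_append {F : Stream' A → β} (hF : IsLocallyConstant F) (s : List A) :
    IsLocallyConstant fun z => F (s ++ₛ z) :=
  hF.comp_continuous (continuous_append s)

variable [DiscreteTopology A] {F : Stream' A → β}

theorem isLocallyConstant_iff_take :
    IsLocallyConstant F ↔ ∀ x, ∃ n, ∀ z, z.take n = x.take n → F z = F x := by
  have hbasis := PiNat.isTopologicalBasis_cylinders fun _ : ℕ => A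
  rw [IsLocallyConstant.iff_exists_open]
  refine forall_congr' fun x => ⟨?_, fun ⟨n, hn⟩ => ?_⟩
  · rintro ⟨V, hV, hxV, hFV⟩
    obtain ⟨_, ⟨y, n, rfl⟩, hxy, hyV⟩ := hbasis.exists_subset_of_mem_open hxV hV
    rw [← PiNat.mem_cylinder_iff_eq.1 hxy] at hyV
    exact ⟨n, fun z hz => hFV z (hyV (take_eq_take_iff.1 hz))⟩
  · exact ⟨PiNat.cylinder x n, hbasis.isOpen ⟨x, n, rfl⟩, PiNat.self_mem_cylinder x n,
      fun z hz => hn z (take_eq_take_iff.2 hz)⟩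

theorem isLocallyConstant_take {k : Stream' A → ℕ} (hk : IsLocallyConstant k) :
    IsLocallyConstant fun x : Stream' A => x.take (k x) := by
  rw [isLocallyConstant_iff_take] at hk ⊢
  intro x
  obtain ⟨n, hn⟩ := hk x
  refine ⟨max n (k x), fun z hz => ?_⟩
  have take_of_le {m : ℕ} (hm : m ≤ max n (k x)) : z.take m = x.take m := by
    simpa [take_take, hm] using congrArg (List.take m) hz
  rw [hn z (take_of_le (le_max_left ..)), take_of_le (le_max_right ..)]

end Stream

section BranchFilter

variable {A : Type*} {l : Filter A}

/-- The filter on infinite sequences generated by the sets of branches of the `l`-branching trees,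
that is, of the trees in which every node `s` has `l`-almost all of its possible children
`s ++ [a]`. It is the infinite iterate of the Fubini powers of `l`. -/
def branchFilter (l : Filter A) : Filter (Stream' A) where
  sets := {D | ∃ T : List A → Set A, (∀ s, T s ∈ l) ∧
    ∀ x : Stream' A, (∀ n, x.get n ∈ T (x.take n)) → x ∈ D}
  univ_sets := ⟨fun _ => Set.univ, fun _ => univ_mem, fun _ _ => Set.mem_univ _⟩
  sets_of_superset := fun ⟨T, hT, hD⟩ hDE => ⟨T, hT, fun x hx => hDE (hD x hx)⟩
  inter_sets := fun ⟨T, hT, hD⟩ ⟨T', hT', hE⟩ => ⟨fun s => T s ∩ T' s,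
    fun s => inter_mem (hT s) (hT' s),
    fun x hx => ⟨hD x fun n => (hx n).1, hE x fun n => (hx n).2⟩⟩

instance [NeBot l] : NeBot (branchFilter l) := by
  refine neBot_iff.2 fun hbot => ?_
  obtain ⟨T, hT, hD⟩ := empty_mem_iff_bot.2 hbot
  choose p hp using fun s => nonempty_of_mem (hT s)
  obtain ⟨x, hx⟩ := exists_get_eq_take p
  exact hD x fun n => hx n ▸ hp _

theorem eventually_branchFilter_cons {D : Stream' A → Prop} :
    (∀ᶠ x in branchFilter l, D x) ↔ ∀ᶠ a in l, ∀ᶠ x in branchFilter l, D (a :: x) := by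
  constructor
  · rintro ⟨T, hT, hD⟩
    filter_upwards [hT []] with a ha
    refine ⟨fun s => T (a :: s), fun s => hT _, fun x hx => hD _ ?_⟩
    rintro (_ | n)
    · exact ha
    · exact hx n
  · intro h
    have hgood (a : A) : ∀ᶠ x in branchFilter l,
        (∀ᶠ z in branchFilter l, D (a :: z)) → D (a :: x) :=
      eventually_imp_distrib_left.2 id
    choose T hT hTD using hgood
    let T' : List A → Set A
      | [] => {a | ∀ᶠ x in branchFilter l, D (a :: x)}
      | List.cons a s => T a s
    refine ⟨T', ?_, fun x hx => ?_⟩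
    · rintro (_ | ⟨a, s⟩)
      exacts [h, hT a s]
    · rw [← Stream'.eta x]
      exact hTD x.head x.tail (fun n => hx (n + 1)) (hx 0)

theorem eventually_forall_take {p : List A → Prop} (h₀ : p [])
    (h : ∀ s, p s → ∀ᶠ a in l, p (s ++ [a])) : ∀ᶠ x in branchFilter l, ∀ n, p (x.take n) := by
  refine ⟨fun s => {a | p s → p (s ++ [a])}, fun s => eventually_imp_distrib_left.2 (h s),
    fun x hx n => ?_⟩
  induction n with
  | zero => exact h₀
  | succ n ih => exact take_succ' (s := x) n ▸ hx n ih

theorem eventually_forall_take_append {D : Stream' A → Prop} (hD : ∀ᶠ x in branchFilter l, D x) :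
    ∀ᶠ x in branchFilter l, ∀ n, ∀ᶠ z in branchFilter l, D (x.take n ++ₛ z) := by
  refine eventually_forall_take (p := fun s => ∀ᶠ z in branchFilter l, D (s ++ₛ z)) hD
    fun s hs => ?_
  simp only [append_append_stream]
  exact eventually_branchFilter_cons.1 hs

/-- A diagonal intersection, which replaces countable completeness: `branchFilter l` does not have
the latter, but the event indexed by a prefix only restricts the terms after that prefix. -/
theorem eventually_forall_take_drop {D : List A → Stream' A → Prop}
    (hD : ∀ s, ∀ᶠ x in branchFilter l, D s x) :
    ∀ᶠ x in branchFilter l, ∀ n, D (x.take n) (x.drop n) := by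
  choose T hT hTD using hD
  refine ⟨fun s => {a | ∀ m ≤ s.length, a ∈ T (s.take m) (s.drop m)}, fun s => ?_,
    fun x hx n => hTD _ _ fun m => ?_⟩
  · exact (eventually_all_finite (Set.finite_Iic s.length)).2 fun m _ => hT _ _
  · have h := hx (n + m) n (by simp)
    rwa [take_add, List.take_left' (length_take n x), List.drop_left' (length_take n x),
      ← get_drop] at h

theorem eventually_forall_drop {D : Stream' A → Prop} (hD : ∀ᶠ x in branchFilter l, D x) :
    ∀ᶠ x in branchFilter l, ∀ n, D (x.drop n) :=
  eventually_forall_take_drop fun _ => hD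

theorem eventually_tail {D : Stream' A → Prop} (hD : ∀ᶠ x in branchFilter l, D x) :
    ∀ᶠ x in branchFilter l, D x.tail :=
  (eventually_forall_drop hD).mono fun _ hx => hx 1

theorem eventually_strictMono [Preorder A] (hl : ∀ a, ∀ᶠ b in l, a < b) :
    ∀ᶠ x in branchFilter l, StrictMono x.get := by
  refine ⟨fun s => {b | ∀ a ∈ s, a < b}, fun s => ?_, fun x hx => strictMono_nat_of_lt_succ
    fun n => hx (n + 1) _ (by simp [← concat_take_get])⟩
  exact (eventually_all_finite (List.finite_toSet s)).2 fun a _ => hl a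

end BranchFilter

section LocallyConstant

variable {A β : Type*} [TopologicalSpace A] [DiscreteTopology A] {U : Ultrafilter A}
  {F : Stream' A → β}

theorem eventually_or_eventually_not {D : Stream' A → Prop} (hD : IsLocallyConstant D) :
    (∀ᶠ x in branchFilter U, D x) ∨ ∀ᶠ x in branchFilter U, ¬ D x := by
  by_contra h
  let undecided (s : List A) : Prop :=
    ¬ ((∀ᶠ z in branchFilter U, D (s ++ₛ z)) ∨ ∀ᶠ z in branchFilter U, ¬ D (s ++ₛ z))
  have undecided_child (s : List A) (hs : undecided s) :
      ∀ᶠ a in (U : Filter A), undecided (s ++ [a]) := by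
    rw [Ultrafilter.eventually_not, Ultrafilter.eventually_or]
    simp only [append_append_stream]
    exact hs ∘ Or.imp (eventually_branchFilter_cons (D := fun z => D (s ++ₛ z))).2
      (eventually_branchFilter_cons (D := fun z => ¬ D (s ++ₛ z))).2
  obtain ⟨x, hx⟩ := (eventually_forall_take (p := undecided) h undecided_child).exists
  obtain ⟨n, hn⟩ := isLocallyConstant_iff_take.1 hD x
  have hconst (z : Stream' A) : D (x.take n ++ₛ z) = D x := hn _ (take_take_append x z le_rfl)
  apply hx n
  simp only [hconst]
  exact (em (D x)).imp (fun h => .of_forall fun _ => h) fun h => .of_forall fun _ => h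

theorem frequently_iff_eventually {D : Stream' A → Prop} (hD : IsLocallyConstant D) :
    (∃ᶠ x in branchFilter U, D x) ↔ ∀ᶠ x in branchFilter U, D x :=
  ⟨(eventually_or_eventually_not hD).resolve_right, Eventually.frequently⟩

/-- The image of `branchFilter U` under a locally constant function, as an ultrafilter: its
generic value. -/
def valueUltrafilter (U : Ultrafilter A) (hF : IsLocallyConstant F) : Ultrafilter β :=
  .ofComplNotMemIff (map F (branchFilter U)) fun S => frequently_iff_eventually (hF.comp (· ∈ S))

theorem eventually_not_tail_lt [LT β] [WellFoundedLT β] (hF : IsLocallyConstant F) :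
    ∀ᶠ x in branchFilter U, ¬ F x.tail < F x := by
  have hD : IsLocallyConstant fun x => F x.tail < F x :=
    (hF.comp_continuous continuous_streamTail).comp₂ hF (· < ·)
  refine (eventually_or_eventually_not hD).resolve_left fun h => ?_
  obtain ⟨x, hx⟩ := (eventually_forall_drop h).exists
  obtain ⟨n, hn⟩ := WellFounded.not_rel_apply_succ (r := (· < ·)) fun n => F (x.drop n)
  exact hn (tail_drop' (s := x) ▸ hx n)

end LocallyConstant

section Settling

variable {A β : Type*} {l : Filter A} {F : Stream' A → β}

/-- `F` is settled at `s` if its value is almost surely determined once `s` is known. -/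
def IsSettled (l : Filter A) (F : Stream' A → β) (s : List A) : Prop :=
  ∃ c, ∀ᶠ z in branchFilter l, F (s ++ₛ z) = c

/-- The length of the shortest prefix of `x` at which `F` is settled; it exists when `F` is locally
constant. -/
noncomputable def settlingTime (l : Filter A) (F : Stream' A → β) (x : Stream' A) : ℕ :=
  sInf {n | IsSettled l F (x.take n)}

/-- The longest prefix of `x` at which `F` is not settled, provided it is not settled at `[]`. -/
noncomputable def settlingStem (l : Filter A) (F : Stream' A → β) (x : Stream' A) : List A :=
  x.take (settlingTime l F x - 1)

theorem settlingTime_le {x : Stream' A} {n : ℕ} (h : IsSettled l F (x.take n)) :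
    settlingTime l F x ≤ n :=
  Nat.sInf_le h

theorem not_isSettled_settlingStem (h : ¬ IsSettled l F []) (x : Stream' A) :
    ¬ IsSettled l F (settlingStem l F x) := by
  obtain h0 | h0 := (settlingTime l F x).eq_zero_or_pos
  · simpa [settlingStem, h0] using h
  · exact Nat.notMem_of_lt_sInf (Nat.sub_lt h0 one_pos)

theorem eventually_eq_of_settled [NeBot l] : ∀ᶠ x in branchFilter l, ∀ n c,
    (∀ᶠ z in branchFilter l, F (x.take n ++ₛ z) = c) → F x = c := by
  have h (s : List A) : ∀ᶠ x in branchFilter l, ∀ c,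
      (∀ᶠ z in branchFilter l, F (s ++ₛ z) = c) → F (s ++ₛ x) = c := by
    by_cases hs : IsSettled l F s
    · obtain ⟨c, hc⟩ := hs
      filter_upwards [hc] with x hx c' hc'
      obtain ⟨z, hz, hz'⟩ := (hc.and hc').exists
      exact hx.trans (hz.symm.trans hz')
    · exact .of_forall fun x c hc => absurd ⟨c, hc⟩ hs
  filter_upwards [eventually_forall_take_drop h] with x hx n
  simpa only [append_take_drop] using hx n

theorem eventually_tail_eq_of_isSettled (h : IsSettled l F []) :
    ∀ᶠ x in branchFilter l, F x = F x.tail := by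
  obtain ⟨c, hc⟩ := h
  filter_upwards [hc, eventually_tail hc] with x hx hx'
  exact hx.trans hx'.symm

variable [TopologicalSpace A] [DiscreteTopology A]

theorem isSettled_take_settlingTime (hF : IsLocallyConstant F) (x : Stream' A) :
    IsSettled l F (x.take (settlingTime l F x)) := by
  obtain ⟨n, hn⟩ := isLocallyConstant_iff_take.1 hF x
  exact Nat.sInf_mem (s := {n | IsSettled l F (x.take n)})
    ⟨n, F x, .of_forall fun z => hn _ (take_take_append x z le_rfl)⟩

theorem settlingTime_pos (hF : IsLocallyConstant F) (h : ¬ IsSettled l F []) (x : Stream' A) :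
    0 < settlingTime l F x := by
  refine Nat.pos_of_ne_zero fun h₀ => h ?_
  simpa only [h₀, take_zero] using isSettled_take_settlingTime (l := l) hF x

theorem isLocallyConstant_settlingTime (hF : IsLocallyConstant F) :
    IsLocallyConstant (settlingTime l F) := by
  refine isLocallyConstant_iff_take.2 fun x => ⟨settlingTime l F x, fun z hz => ?_⟩
  have take_eq {m : ℕ} (hm : m ≤ settlingTime l F x) : z.take m = x.take m := by
    simpa [take_take, hm] using congrArg (List.take m) hz
  have hle : settlingTime l F z ≤ settlingTime l F x :=
    settlingTime_le (hz ▸ isSettled_take_settlingTime hF x)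
  exact hle.antisymm (settlingTime_le (take_eq hle ▸ isSettled_take_settlingTime hF z))

theorem isLocallyConstant_settlingStem (hF : IsLocallyConstant F) :
    IsLocallyConstant (settlingStem l F) :=
  isLocallyConstant_take ((isLocallyConstant_settlingTime hF).comp (· - 1))

theorem eventually_take_append_eq [NeBot l] (hF : IsLocallyConstant F) :
    ∀ᶠ x in branchFilter l, ∀ n ≥ settlingTime l F x,
      ∀ᶠ z in branchFilter l, F (x.take n ++ₛ z) = F x := by
  have h := eventually_eq_of_settled (l := l) (F := F)
  filter_upwards [h, eventually_forall_take_append h] with x hx hx' n hn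
  obtain ⟨c, hc⟩ := isSettled_take_settlingTime hF x
  filter_upwards [hx' n] with z hz
  rw [hx _ c hc]
  exact hz (settlingTime l F x) c (by rwa [take_take_append x z hn])

end Settling

section LimitIdeal

variable {P : Type*}

/-- The limit ideal of a filter on `P`: the elements below almost all elements of `P`. For an
ultrafilter on a well-quasi-order it is directed and contains almost all elements of `P`. -/
def limitIdeal [Preorder P] (l : Filter P) : LowerSet P where
  carrier := {y | ∀ᶠ p in l, y ≤ p}
  lower' _ _ hba ha := ha.mono fun _ => hba.trans

theorem exists_mem_limitIdeal [Preorder P] [WellQuasiOrderedLE P] {V : Ultrafilter P} {S : P → Prop}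
    (hS : ∀ᶠ p in (V : Filter P), S p) : ∃ y ∈ limitIdeal (V : Filter P), S y := by
  by_contra! h
  obtain ⟨f, -, hf⟩ := exists_seq_of_forall_finset_exists S (fun a b => ¬ a ≤ b) fun s hs => by
    have hs' : ∀ᶠ p in (V : Filter P), ∀ a ∈ s, ¬ a ≤ p := (eventually_all_finset s).2 fun a ha =>
      Ultrafilter.eventually_not.2 fun ha' => h a ha' (hs a ha)
    exact (hS.and hs').exists
  obtain ⟨m, n, hmn, hle⟩ := wellQuasiOrdered_le f
  exact hf m n hmn hle

theorem eventually_mem_limitIdeal [Preorder P] [WellQuasiOrderedLE P] (V : Ultrafilter P) :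
    ∀ᶠ p in (V : Filter P), p ∈ limitIdeal (V : Filter P) := by
  by_contra h
  obtain ⟨y, hy, hy'⟩ := exists_mem_limitIdeal (Ultrafilter.eventually_not.2 h)
  exact hy' hy

instance [Preorder P] [WellQuasiOrderedLE P] : WellFoundedLT (LowerSet P) := by
  refine ⟨wellFounded_iff_isEmpty_descending_chain.2 ⟨fun ⟨I, hI⟩ => ?_⟩⟩
  choose y hy hy' using fun n => Set.exists_of_ssubset (hI n)
  have hanti : Antitone I := antitone_nat_of_succ_le fun n => (hI n).le
  obtain ⟨m, n, hmn, hle⟩ := wellQuasiOrdered_le y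
  exact hy' m ((I (m + 1)).lower hle (hanti hmn (hy n)))

/-- The orders without a suborder `2 + 2`, the disjoint union of two chains `a < b` and `c < d`. By
Fishburn's theorem these are exactly the interval orders. -/
def IsTwoPlusTwoFree (P : Type*) [LT P] : Prop :=
  ∀ a b c d : P, a < b → c < d → a < d ∨ c < b

variable [PartialOrder P] [WellQuasiOrderedLE P] {V W : Ultrafilter P}

theorem exists_gt_mem_limitIdeal (hV : ∀ c, ¬ ∀ᶠ p in (V : Filter P), p = c) {y : P}
    (hy : y ∈ limitIdeal (V : Filter P)) : ∃ z ∈ limitIdeal (V : Filter P), y < z := by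
  have hne : ∀ᶠ p in (V : Filter P), p ≠ y := Ultrafilter.eventually_not.2 (hV y)
  exact exists_mem_limitIdeal ((Eventually.and hy hne).mono fun p hp => hp.1.lt_of_ne hp.2.symm)

theorem IsTwoPlusTwoFree.limitIdeal_le_total (hP : IsTwoPlusTwoFree P)
    (hV : ∀ c, ¬ ∀ᶠ p in (V : Filter P), p = c) (hW : ∀ c, ¬ ∀ᶠ p in (W : Filter P), p = c) :
    limitIdeal (V : Filter P) ≤ limitIdeal W ∨ limitIdeal (W : Filter P) ≤ limitIdeal V := by
  by_contra! h
  obtain ⟨a, haV, haW⟩ := Set.not_subset.1 h.1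
  obtain ⟨c, hcW, hcV⟩ := Set.not_subset.1 h.2
  obtain ⟨b, hb, hab⟩ := exists_gt_mem_limitIdeal hV haV
  obtain ⟨d, hd, hcd⟩ := exists_gt_mem_limitIdeal hW hcW
  rcases hP a b c d hab hcd with had | hcb
  · exact haW ((limitIdeal _).lower had.le hd)
  · exact hcV ((limitIdeal _).lower hcb.le hb)

end LimitIdeal

section Shift

variable {A P : Type*}

/-- The limit ideal of the values that `F` takes beyond the prefix `s`. -/
def idealAfter [Preorder P] (l : Filter A) (F : Stream' A → P) (s : List A) : LowerSet P :=
  limitIdeal (map (fun z => F (s ++ₛ z)) (branchFilter l))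

variable [TopologicalSpace A] [DiscreteTopology A] {U : Ultrafilter A} {F : Stream' A → P}

theorem eventually_mem_idealAfter_take [Preorder P] [WellQuasiOrderedLE P]
    (hF : IsLocallyConstant F) :
    ∀ᶠ x in branchFilter U, ∀ n, F x ∈ idealAfter U F (x.take n) := by
  have h (s : List A) : ∀ᶠ z in branchFilter U, F (s ++ₛ z) ∈ idealAfter U F s :=
    eventually_mem_limitIdeal (valueUltrafilter U (isLocallyConstant_append hF s))
  filter_upwards [eventually_forall_take_drop h] with x hx n
  simpa only [append_take_drop] using hx n

variable [PartialOrder P] [WellQuasiOrderedLE P]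

theorem IsTwoPlusTwoFree.idealAfter_le_total (hP : IsTwoPlusTwoFree P) (hF : IsLocallyConstant F)
    {s t : List A} (hs : ¬ IsSettled U F s) (ht : ¬ IsSettled U F t) :
    idealAfter U F s ≤ idealAfter U F t ∨ idealAfter U F t ≤ idealAfter U F s :=
  hP.limitIdeal_le_total (V := valueUltrafilter U (isLocallyConstant_append hF s))
    (W := valueUltrafilter U (isLocallyConstant_append hF t)) (not_exists.1 hs) (not_exists.1 ht)

theorem IsTwoPlusTwoFree.eventually_idealAfter_stem_le (hP : IsTwoPlusTwoFree P)
    (hF : IsLocallyConstant F) (h : ¬ IsSettled U F []) :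
    ∀ᶠ x in branchFilter U,
      idealAfter U F (settlingStem U F x) ≤ idealAfter U F (settlingStem U F x.tail) := by
  have hI := (isLocallyConstant_settlingStem (l := U) hF).comp (idealAfter U F)
  filter_upwards [eventually_not_tail_lt hI] with x hx
  exact (hP.idealAfter_le_total hF (not_isSettled_settlingStem h x)
    (not_isSettled_settlingStem h x.tail)).elim id fun hle => (hle.eq_of_not_lt hx).ge

theorem IsTwoPlusTwoFree.eventually_le_tail (hP : IsTwoPlusTwoFree P) (hF : IsLocallyConstant F) :
    ∀ᶠ x in branchFilter U, F x ≤ F x.tail := by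
  by_cases h : IsSettled U F []
  · exact (eventually_tail_eq_of_isSettled h).mono fun _ => le_of_eq
  have hD : IsLocallyConstant fun x => F x ≤ F x.tail :=
    hF.comp₂ (hF.comp_continuous continuous_streamTail) (· ≤ ·)
  rw [← frequently_iff_eventually hD]
  intro hbad
  obtain ⟨x, htime, hideal, hmem, hsettled, hbad⟩ :=
    ((eventually_not_tail_lt (isLocallyConstant_settlingTime (l := U) hF)).and
    ((hP.eventually_idealAfter_stem_le hF h).and ((eventually_mem_idealAfter_take hF).and
    ((eventually_take_append_eq hF).and (eventually_forall_take_append hbad))))).exists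
  obtain ⟨n, hn⟩ := Nat.exists_eq_add_one.2 (settlingTime_pos hF h x.tail)
  -- The continuations of `x.tail.take n`, the stem of `x.tail`, are the tails of those of
  -- `x.take (n + 1)`, after which `F` is settled since `settlingTime U F x ≤ n + 1`.
  have hle : ∀ᶠ z in branchFilter U, F x ≤ F (x.tail.take n ++ₛ z) := by
    have := hideal (hmem _)
    rwa [settlingStem, hn] at this
  have heq : ∀ᶠ z in branchFilter U, F (x.take (n + 1) ++ₛ z) = F x := hsettled (n + 1) (by omega)
  obtain ⟨z, hz_le, hz_eq, hz_bad⟩ := (hle.and (heq.and (hbad (n + 1)))).exists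
  exact hz_bad (hz_eq.trans_le hz_le)

end Shift

section Barrier

variable {B : Set (Finset ℕ)}

theorem infinite_base (hB : B.Infinite) : (base B).Infinite := fun h =>
  hB ((h.finite_subsets.preimage Finset.coe_injective.injOn).subset fun s hs _ ha => ⟨s, hs, ha⟩)

theorem IsInit.exists_eq_image_range {s : Finset ℕ} {g : ℕ → ℕ} (hs : IsInit s (Set.range g))
    (hg : StrictMono g) : ∃ n, s = (Finset.range n).image g := by
  have hex : ∃ n, g n ∉ s := by
    by_contra! h
    exact Set.infinite_range_of_injective hg.injective
      (s.finite_toSet.subset (Set.range_subset_iff.2 h))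
  classical
  have hmem (i : ℕ) : g i ∈ s ↔ i < Nat.find hex := by
    refine ⟨fun hi => ?_, fun hi => not_not.1 (Nat.find_min hex hi)⟩
    by_contra! hle
    exact Nat.find_spec hex (hs.2 _ ⟨_, rfl⟩ _ hi (hg.monotone hle))
  refine ⟨Nat.find hex, Finset.ext fun a => ?_⟩
  simp only [Finset.mem_image, Finset.mem_range, ← hmem]
  refine ⟨fun ha => ?_, fun ⟨_, hi, hia⟩ => hia ▸ hi⟩
  obtain ⟨i, rfl⟩ := hs.1 ha
  exact ⟨i, ha, rfl⟩

theorem tri_image_range {g : ℕ → ℕ} (hg : StrictMono g) {m n : ℕ} (h : n ≤ m) :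
    Tri ((Finset.range n).image g) ((Finset.range m).image fun i => g (i + 1)) := by
  have mem_range {k i : ℕ} : g i ∈ (Finset.range k).image g ↔ i < k := by
    simp [hg.injective.eq_iff]
  refine ⟨(Finset.range (m + 1)).image g, ⟨?_, ?_⟩, fun heq => ?_, ?_⟩
  · exact_mod_cast Finset.image_subset_image (Finset.range_subset_range.2 (by omega))
  · simp only [Finset.mem_coe, Finset.forall_mem_image, mem_range, hg.le_iff_le, Finset.mem_range]
    omega
  · have hm : g m ∈ (Finset.range n).image g := heq ▸ mem_range.2 m.lt_succ_self
    exact h.not_gt (mem_range.1 hm)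
  · ext a
    simp only [tail, Finset.mem_filter, Finset.mem_image, Finset.mem_range]
    constructor
    · rintro ⟨i, hi, rfl⟩
      exact ⟨⟨i + 1, by omega, rfl⟩, g 0, ⟨0, by omega, rfl⟩, hg i.succ_pos⟩
    · rintro ⟨⟨_ | i, hi, rfl⟩, _, ⟨j, -, rfl⟩, hji⟩
      · exact absurd (hg.lt_iff_lt.1 hji) j.not_lt_zero
      · exact ⟨i, by omega, rfl⟩

/-- The element `s` of the barrier `B`, listed increasingly, is a prefix of the sequence `x`. Only
this prefix of `x` is required to be increasing, which makes the relation locally constant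
in `x`. -/
def IsBarPrefix (x : Stream' (base B)) (s : B) : Prop :=
  ∃ n, s.1 = (Finset.range n).image (fun i => (x.get i : ℕ)) ∧ StrictMonoOn x.get (Set.Iio n)

theorem IsBarPrefix.unique (hB : IsAntichain (· ⊆ ·) B) {x : Stream' (base B)} {s t : B}
    (hs : IsBarPrefix x s) (ht : IsBarPrefix x t) : s = t := by
  obtain ⟨n, hs, -⟩ := hs
  obtain ⟨m, ht, -⟩ := ht
  wlog h : n ≤ m generalizing n m s t
  · exact (this m ht n hs (le_of_not_ge h)).symm
  refine Subtype.ext (hB.eq s.2 t.2 ?_)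
  rw [hs, ht]
  exact Finset.image_subset_image (Finset.range_subset_range.2 h)

theorem exists_isBarPrefix (hB : IsBlock B) {x : Stream' (base B)} (hx : StrictMono x.get) :
    ∃ s, IsBarPrefix x s := by
  have hg : StrictMono fun i => (x.get i : ℕ) := fun _ _ h => hx h
  obtain ⟨s, hs, -, hinit⟩ := hB.2 _ (Set.infinite_range_of_injective hg.injective)
    (Set.range_subset_iff.2 fun i => (x.get i).2)
  obtain ⟨n, hn⟩ := hinit.exists_eq_image_range hg
  exact ⟨⟨s, hs⟩, n, hn, hx.strictMonoOn _⟩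

theorem isBarPrefix_congr {x z : Stream' (base B)} {s : B} {n : ℕ}
    (h : ∀ i < n, z.get i = x.get i) (hs : s.1 = (Finset.range n).image fun i => (x.get i : ℕ))
    (hx : StrictMonoOn x.get (Set.Iio n)) : IsBarPrefix z s := by
  refine ⟨n, hs.trans (Finset.image_congr fun i hi => ?_), hx.congr fun i hi => (h i hi).symm⟩
  rw [h i (Finset.mem_range.1 hi)]

theorem isLocallyConstant_isBarPrefix (hB : IsBarrier B) :
    IsLocallyConstant (IsBarPrefix (B := B)) := by
  simp only [isLocallyConstant_iff_take, take_eq_take_iff]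
  intro x
  by_cases h : ∃ s, IsBarPrefix x s
  · obtain ⟨s, n, hs, hx⟩ := h
    have hxs : IsBarPrefix x s := ⟨n, hs, hx⟩
    refine ⟨n, fun z hz => funext fun t => propext ?_⟩
    have hzs : IsBarPrefix z s := isBarPrefix_congr hz hs hx
    exact ⟨fun ht => hzs.unique hB.2 ht ▸ hxs, fun ht => hxs.unique hB.2 ht ▸ hzs⟩
  · obtain ⟨i, hi⟩ : ∃ i, ¬ x.get i < x.get (i + 1) := by
      by_contra! hx
      exact h (exists_isBarPrefix hB.1 (strictMono_nat_of_lt_succ hx))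
    refine ⟨i + 2, fun z hz => funext fun t => propext ⟨?_, fun ht => absurd ⟨t, ht⟩ h⟩⟩
    rintro ⟨m, ht, hm⟩
    obtain hmi | hmi := lt_or_ge m (i + 2)
    · exact absurd ⟨t, isBarPrefix_congr (fun j hj => (hz j (by omega)).symm) ht hm⟩ h
    · rw [← hz i (by omega), ← hz (i + 1) (by omega)] at hi
      exact absurd (hm (Set.mem_Iio.2 (by omega)) (Set.mem_Iio.2 (by omega)) i.lt_succ_self) hi

theorem IsBarPrefix.tri (hB : IsAntichain (· ⊆ ·) B) {x : Stream' (base B)}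
    (hx : StrictMono x.get) {s t : B} (hs : IsBarPrefix x s) (ht : IsBarPrefix x.tail t) :
    Tri s t := by
  obtain ⟨n, hs, -⟩ := hs
  obtain ⟨m, ht, -⟩ := ht
  let g (i : ℕ) : ℕ := x.get i
  have hg : StrictMono g := fun _ _ h => hx h
  replace ht : t.1 = (Finset.range m).image fun i => g (i + 1) := ht
  suffices hnm : n ≤ m by
    rw [hs, ht]
    exact tri_image_range hg hnm
  by_contra! hmn
  have hts : t.1 ⊆ s.1 := by
    simp only [hs, ht, Finset.image_subset_iff, Finset.mem_range]
    exact fun i hi => Finset.mem_image_of_mem g (Finset.mem_range.2 (by omega))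
  have h₀ : g 0 ∈ t.1 := by
    rw [hB.eq t.2 s.2 hts, hs]
    exact Finset.mem_image_of_mem g (Finset.mem_range.2 (by omega))
  rw [ht] at h₀
  obtain ⟨i, -, hi⟩ := Finset.mem_image.1 h₀
  exact i.succ_ne_zero (hg.injective hi)

theorem IsBarrier.isGood {P : Type*} [PartialOrder P] [WellQuasiOrderedLE P]
    (hP : IsTwoPlusTwoFree P) (hB : IsBarrier B) (f : B → P) : IsGood f := by
  have : Nonempty B := hB.1.1.nonempty.to_subtype
  have : Infinite (base B) := (infinite_base hB.1.1).to_subtype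
  let F (x : Stream' (base B)) : P := f (Classical.epsilon (IsBarPrefix x))
  have hF : IsLocallyConstant F :=
    (isLocallyConstant_isBarPrefix hB).comp fun p => f (Classical.epsilon p)
  have hgt (a : base B) : ∀ᶠ b in (hyperfilter (base B) : Filter (base B)), a < b := by
    have hfin : (Set.Iic a).Finite :=
      (Set.finite_Iic (a : ℕ)).preimage Subtype.val_injective.injOn
    filter_upwards [hfin.compl_mem_hyperfilter] with b hb using not_le.1 hb
  obtain ⟨x, hx, hle⟩ := ((eventually_strictMono hgt).and (hP.eventually_le_tail hF)).exists
  have hx' : StrictMono x.tail.get := fun _ _ h => hx (Nat.succ_lt_succ h)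
  exact ⟨_, _, (Classical.epsilon_spec (exists_isBarPrefix hB.1 hx)).tri hB.2 hx
    (Classical.epsilon_spec (exists_isBarPrefix hB.1 hx')), hle⟩

theorem IsTwoPlusTwoFree.isBqo {P : Type*} [PartialOrder P] [WellQuasiOrderedLE P]
    (hP : IsTwoPlusTwoFree P) : IsBqo P :=
  fun _ _ _ hB _ f => hB.isGood hP f

end Barrier

section Singletons

theorem lexLT_singleton {m n : ℕ} : LexLT {m} {n} ↔ m < n := by
  simp [LexLT]

theorem lt_of_tri_singleton {m n : ℕ} (h : Tri {m} {n}) : m < n := by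
  obtain ⟨r, hr, -, ht⟩ := h
  obtain ⟨hnr, y, hy, hyn⟩ := Finset.mem_filter.1 (ht ▸ Finset.mem_singleton_self n : n ∈ tail r)
  by_contra! hnm
  have eq_m {k : ℕ} (hk : k ∈ r) (hkm : k ≤ m) : k = m :=
    Finset.mem_singleton.1 (hr.2 k hk m (Finset.mem_singleton_self m) hkm)
  exact hyn.ne ((eq_m hy (hyn.le.trans hnm)).trans (eq_m hnr hnm).symm)

theorem isBarrier_singletons : IsBarrier (Set.range fun n : ℕ => ({n} : Finset ℕ)) := by
  refine ⟨⟨Set.infinite_range_of_injective Finset.singleton_injective, fun X hX _ => ?_⟩, ?_⟩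
  · refine ⟨{sInf X}, ⟨_, rfl⟩, Finset.singleton_ne_empty _, ?_, fun x hx y hy hxy => ?_⟩
    · simpa using Nat.sInf_mem hX.nonempty
    · rw [Finset.mem_singleton] at hy ⊢
      exact (hxy.trans_eq hy).antisymm (Nat.sInf_le hx)
  · rintro _ ⟨m, rfl⟩ _ ⟨n, rfl⟩ hne hsub
    exact hne (congrArg _ (Finset.singleton_subset_singleton.1 hsub))

theorem IsBqo.wellQuasiOrderedLE {P : Type*} [LE P] (h : IsBqo P) : WellQuasiOrderedLE P := by
  refine ⟨fun g => ?_⟩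
  let B : Set (Finset ℕ) := Set.range fun n : ℕ => ({n} : Finset ℕ)
  let e : ((· < ·) : ℕ → ℕ → Prop) ≃r (fun s t : B => LexLT s t) :=
    { toEquiv := Equiv.ofInjective _ Finset.singleton_injective
      map_rel_iff' := lexLT_singleton }
  have hwo : IsWellOrder B fun s t => LexLT s t := e.symm.toRelEmbedding.isWellOrder
  have hcard : (Ordinal.type fun s t : B => LexLT s t).card ≤ Cardinal.aleph0 := by
    rw [Ordinal.card_type]
    exact Cardinal.mk_le_aleph0_iff.2 (Set.countable_range _).to_subtype
  obtain ⟨⟨_, m, rfl⟩, ⟨_, n, rfl⟩, htri, hle⟩ :=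
    h _ hcard B isBarrier_singletons ⟨hwo, le_rfl⟩ fun s => g (∑ i ∈ s.1, i)
  exact ⟨m, n, lt_of_tri_singleton htri, by simpa only [Finset.sum_singleton] using hle⟩

end Singletons

theorem IsIntervalOrder.isTwoPlusTwoFree {P : Type u} [PartialOrder P]
    (hP : IsIntervalOrder.{u, v} P) : IsTwoPlusTwoFree P := by
  intro a b c d hab hcd
  obtain ⟨C, _, S, ⟨e⟩⟩ := hP
  have lt_iff (p q : P) : p < q ↔ ∀ x ∈ (e p).1.1, ∀ y ∈ (e q).1.1, x < y := e.lt_iff_lt.symm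
  rw [lt_iff] at hab hcd ⊢
  rw [lt_iff]
  by_contra! h
  obtain ⟨⟨x, hx, y, hy, hyx⟩, u, hu, v, hv, hvu⟩ := h
  exact hyx.not_gt (((hab x hx v hv).trans_le hvu).trans (hcd u hu y hy))

end Bqo

/-- An interval order is better-quasi-ordered if and only if it is well-quasi-ordered. -/
theorem theorem1p6 (P : Type u) [PartialOrder P] (hP : Bqo.IsIntervalOrder.{u, v} P) :
    Bqo.IsBqo P ↔ WellQuasiOrderedLE P :=
  ⟨fun h => h.wellQuasiOrderedLE, fun _ => hP.isTwoPlusTwoFree.isBqo⟩
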